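/- Let $(X,\mu)$ be a standard probability space and let $\mathcal R$ be a non-singular equivalence relation on $(X,\mu)$, i.e. the orbit equivalence relation of an action of a countable group by Borel bijections of $X$ preserving the class of $\mu$-null sets. Suppose that $\mathcal R$ is aperiodic, i.e. almost every $\mathcal R$-class is infinite. Equip $\mathcal R$ with the measure $M(A)=\int_X |\{y:(x,y)\in A\}|\,d\mu(x)$, let $m$ be any finite measure on $\mathcal R$ equivalent to $M$, and let $\mathrm{Sub}(\mathcal R)$ be the space of Borel equivalence relations $\mathcal S\subseteq\mathcal R$, identified when they differ by an $M$-null set, with the topology of the metric $d_m(\mathcal S,\mathcal T)=m(\mathcal S\bigtriangleup\mathcal T)$ (this topology does not depend on $m$). Let $\mathrm{Sub}_{[<\infty]}(\mathcal R)$ be the set of $\mathcal S\in\mathrm{Sub}(\mathcal R)$ of finite index, i.e. such that almost every $\mathcal R$-class is a union of finitely many $\mathcal S$-classes, and for $k\in\mathbb N$ let $\mathrm{Sub}_{[\le k]}(\mathcal R)$ be the set of those $\mathcal S$ such that almost every $\mathcal R$-class is a union of at most $k$ $\mathcal S$-classes. Call a subset $A$ of a Polish space $Y$ $F_{\sigma\delta}$-hard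 (resp. $F_\sigma$-hard) if for every zero-dimensional Polish space $Z$ and every $F_{\sigma\delta}$ (resp. $F_\sigma$) set $B\subseteq Z$ there is a continuous $f:Z\to Y$ with $f^{-1}(A)=B$, and $F_\sigma$-complete if it is $F_\sigma$ and $F_\sigma$-hard. Say that $\mathcal R$ has finitely many ergodic components if $X$ is the disjoint union of finitely many $\mathcal R$-invariant Borel sets of positive measure on each of which $\mathcal R$ is ergodic, and infinitely many otherwise. Then: 1. $\mathrm{Sub}_{[<\infty]}(\mathcal R)$ is $F_{\sigma\delta}$-hard if and only if $\mathcal R$ has infinitely many ergodic components; 2. if $\mathcal R$ has only finitely many ergodic components, then $\mathrm{Sub}_{[<\infty]}(\mathcal R)$ is $F_\sigma$-complete; 3. for every $k\in\mathbb N$, the set $\mathrm{Sub}_{[\le k]}(\mathcal R)$ is closed in $\mathrm{Sub}(\mathcal R)$. -/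

import Mathlib

open MeasureTheory Set
open scoped ENNReal

namespace SubRel

/-! ### Descriptive complexity -/

/-- `A` is an `F_σ` set: a countable union of closed sets. -/
def IsFsigma {Y : Type*} [TopologicalSpace Y] (A : Set Y) : Prop :=
  ∃ C : ℕ → Set Y, (∀ n, IsClosed (C n)) ∧ A = ⋃ n, C n

/-- `A` is an `F_σδ` set: a countable intersection of `F_σ` sets. -/
def IsFsigmaDelta {Y : Type*} [TopologicalSpace Y] (A : Set Y) : Prop :=
  ∃ C : ℕ → Set Y, (∀ n, IsFsigma (C n)) ∧ A = ⋂ n, C n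

/-- A space is zero-dimensional if its clopen sets form a basis. -/
def IsZeroDimensional (Z : Type*) [TopologicalSpace Z] : Prop :=
  TopologicalSpace.IsTopologicalBasis {U : Set Z | IsClopen U}

/-- `A` is `F_σ`-hard: every `F_σ` subset of every zero-dimensional Polish space is the preimage
of `A` under a continuous map. -/
def IsFsigmaHard {Y : Type*} [TopologicalSpace Y] (A : Set Y) : Prop :=
  ∀ (Z : Type) [TopologicalSpace Z] [PolishSpace Z], IsZeroDimensional Z →
    ∀ B : Set Z, IsFsigma B → ∃ f : Z → Y, Continuous f ∧ f ⁻¹' A = B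

/-- `A` is `F_σδ`-hard: every `F_σδ` subset of every zero-dimensional Polish space is the preimage
of `A` under a continuous map. -/
def IsFsigmaDeltaHard {Y : Type*} [TopologicalSpace Y] (A : Set Y) : Prop :=
  ∀ (Z : Type) [TopologicalSpace Z] [PolishSpace Z], IsZeroDimensional Z →
    ∀ B : Set Z, IsFsigmaDelta B → ∃ f : Z → Y, Continuous f ∧ f ⁻¹' A = B

/-- `A` is `F_σ`-complete: it is `F_σ` and `F_σ`-hard. -/
def IsFsigmaComplete {Y : Type*} [TopologicalSpace Y] (A : Set Y) : Prop :=
  IsFsigma A ∧ IsFsigmaHard A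

variable {X : Type*}

/-! ### Non-singular equivalence relations -/

/-- An equivalence relation as a subset of `X × X`. -/
def graph (R : Setoid X) : Set (X × X) := {p | R p.1 p.2}

/-- `R` is a non-singular equivalence relation on `(X, μ)`: it is the orbit equivalence relation of
an action of a countable group by Borel bijections such that `μ A = 0 ↔ μ (γ A) = 0` for all
Borel sets `A` and all group elements `γ`. -/
def IsNonsingular [MeasurableSpace X] (R : Setoid X) (μ : Measure X) : Prop :=
  ∃ (Γ : Type) (_ : Group Γ) (_ : Countable Γ) (_ : MulAction Γ X),
    (∀ γ : Γ, Measurable fun x : X => γ • x) ∧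
    (∀ (γ : Γ) (A : Set X), MeasurableSet A → (μ A = 0 ↔ μ ((fun x => γ • x) '' A) = 0)) ∧
    R = MulAction.orbitRel Γ X

/-- `R` is aperiodic: almost all its classes are infinite. -/
def IsAperiodic [MeasurableSpace X] (R : Setoid X) (μ : Measure X) : Prop :=
  ∀ᵐ x ∂μ, {y | R x y}.Infinite

/-- `A` is an ergodic component of `R`: an `R`-invariant Borel set of positive measure on which `R`
is ergodic, i.e. each of its `R`-invariant Borel subsets is null or conull in `A`. -/
def IsErgodicComponent [MeasurableSpace X] (R : Setoid X) (μ : Measure X) (A : Set X) : Prop :=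
  MeasurableSet A ∧ (∀ x y, R x y → (x ∈ A ↔ y ∈ A)) ∧ μ A ≠ 0 ∧
    ∀ B ⊆ A, MeasurableSet B → (∀ x y, R x y → (x ∈ B ↔ y ∈ B)) → μ B = 0 ∨ μ (A \ B) = 0

/-- `R` has finitely many ergodic components: `X` is a finite disjoint union of ergodic
components of `R`. -/
def HasFinitelyManyErgodicComponents [MeasurableSpace X] (R : Setoid X) (μ : Measure X) : Prop :=
  ∃ (n : ℕ) (A : Fin n → Set X), (∀ i, IsErgodicComponent R μ (A i)) ∧
    Pairwise (fun i j => Disjoint (A i) (A j)) ∧ ⋃ i, A i = univ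

/-- `R` has infinitely many ergodic components (this includes a diffuse ergodic decomposition). -/
def HasInfinitelyManyErgodicComponents [MeasurableSpace X] (R : Setoid X) (μ : Measure X) : Prop :=
  ¬ HasFinitelyManyErgodicComponents R μ

/-! ### The space of subequivalence relations -/

/-- The left measure `M(A) = ∫ |A_x| dμ(x)` of a set `A ⊆ X × X`, where `A_x` is the fibre of `A`
above `x`. -/
noncomputable def leftMeasure [MeasurableSpace X] (μ : Measure X) (A : Set (X × X)) : ℝ≥0∞ :=
  ∫⁻ x, (({y | (x, y) ∈ A}.encard : ℕ∞) : ℝ≥0∞) ∂μ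

/-- `m` is a measure on (the graph of) `R` which is equivalent to the left measure. -/
def IsEquivLeftMeasure [MeasurableSpace X] (R : Setoid X) (μ : Measure X) (m : Measure (X × X)) :
    Prop :=
  m (graph R)ᶜ = 0 ∧
    ∀ A ⊆ graph R, MeasurableSet A → (m A = 0 ↔ leftMeasure μ A = 0)

/-- A finite measure equivalent to the left measure always exists. -/
theorem exists_isEquivLeftMeasure [MeasurableSpace X] [StandardBorelSpace X] (μ : Measure X)
    [IsProbabilityMeasure μ] (R : Setoid X) (hR : IsNonsingular R μ) :
    ∃ m : Measure (X × X), IsFiniteMeasure m ∧ IsEquivLeftMeasure R μ m := by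
  obtain ⟨Γ, _, _, _, hmeas, -, rfl⟩ := hR
  obtain ⟨w, hw, hsum⟩ := ENNReal.exists_pos_sum_of_countable' (ε := 1) one_ne_zero Γ
  have hg : ∀ γ : Γ, Measurable fun x : X => (x, γ • x) := fun γ =>
    measurable_id.prodMk (hmeas γ)
  let m : Measure (X × X) := Measure.sum fun γ => w γ • μ.map fun x => (x, γ • x)
  have hm : ∀ A, MeasurableSet A → m A = ∑' γ, w γ * μ {x | (x, γ • x) ∈ A} := by
    intro A hA
    simp only [m, Measure.sum_apply _ hA, Measure.smul_apply, smul_eq_mul]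
    refine tsum_congr fun γ => ?_
    rw [Measure.map_apply (hg γ) hA]
    rfl
  have hnull : ∀ A, MeasurableSet A → (m A = 0 ↔ ∀ γ : Γ, μ {x | (x, γ • x) ∈ A} = 0) := by
    intro A hA
    rw [hm A hA, ENNReal.tsum_eq_zero]
    exact forall_congr' fun γ => by simp [(hw γ).ne']
  have hgr : graph (MulAction.orbitRel Γ X) = ⋃ γ : Γ, {p : X × X | γ • p.1 = p.2} := by
    ext p
    simp only [graph, mem_ofPred_eq, mem_iUnion]
    rw [Setoid.comm']
    exact Iff.rfl
  have hgm : MeasurableSet (graph (MulAction.orbitRel Γ X)) := by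
    rw [hgr]
    exact MeasurableSet.iUnion fun γ =>
      measurableSet_eq_fun ((hmeas γ).comp measurable_fst) measurable_snd
  refine ⟨m, ⟨?_⟩, ?_, ?_⟩
  · rw [hm univ MeasurableSet.univ]
    simpa using hsum.trans ENNReal.one_lt_top
  · rw [hnull _ hgm.compl]
    intro γ
    convert measure_empty (μ := μ)
    ext x
    simp only [mem_ofPred_eq, mem_compl_iff, mem_empty_iff_false, iff_false, not_not]
    rw [hgr]
    exact mem_iUnion.2 ⟨γ, rfl⟩
  · intro A hAR hA
    rw [hnull A hA]
    constructor
    · intro h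
      have : ∀ᵐ x ∂μ, ∀ γ : Γ, (x, γ • x) ∉ A := by
        rw [ae_all_iff]
        intro γ
        rw [ae_iff]
        simpa using h γ
      unfold leftMeasure
      rw [← lintegral_zero (μ := μ)]
      refine lintegral_congr_ae ?_
      filter_upwards [this] with x hx
      have : {y | (x, y) ∈ A} = ∅ := by
        ext y
        simp only [mem_ofPred_eq, mem_empty_iff_false, iff_false]
        intro hy
        have h1 := hAR hy
        rw [hgr] at h1
        obtain ⟨γ, hγ⟩ := mem_iUnion.1 h1
        have h2 : γ • x = y := hγ
        exact hx γ (h2 ▸ hy)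
      simp [this]
    · intro h γ
      have hS : MeasurableSet {x | (x, γ • x) ∈ A} := hg γ hA
      refine le_antisymm ?_ zero_le
      rw [← h, ← lintegral_indicator_one hS]
      refine lintegral_mono fun x => ?_
      by_cases hx : (x, γ • x) ∈ A
      · rw [indicator_of_mem (by exact hx)]
        have : (1 : ℕ∞) ≤ {y | (x, y) ∈ A}.encard := one_le_encard_iff_nonempty.2 ⟨_, hx⟩
        simpa using (ENat.toENNReal_le.2 this)
      · rw [indicator_of_notMem (by exact hx)]
        exact zero_le

/-- `S` is a Borel subequivalence relation of `R`. -/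
def IsBorelSubrelation [MeasurableSpace X] (S R : Setoid X) : Prop :=
  MeasurableSet (graph S) ∧ ∀ x y, S x y → R x y

/-- The measure algebra of `m`: Borel sets up to `m`-null sets, with the metric
`d_m(A, B) = m (A ∆ B)` and its topology. -/
abbrev MeasAlg {Y : Type*} [MeasurableSpace Y] (m : Measure Y) : Type _ :=
  SeparationQuotient (MeasuredSets m)

/-- `a` is the class in the measure algebra of the Borel equivalence relation `S`. -/
def Represents [MeasurableSpace X] {m : Measure (X × X)} (S : Setoid X) (a : MeasAlg m) : Prop :=
  ∃ h : MeasurableSet (graph S),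
    a = SeparationQuotient.mk (X := MeasuredSets m) ⟨graph S, h⟩

/-- The space `Sub(R)`: the elements of the measure algebra of `R` which contain a Borel
subequivalence relation of `R`, with the topology induced by that of the measure algebra. -/
abbrev Sub [MeasurableSpace X] (R : Setoid X) (m : Measure (X × X)) : Type _ :=
  {a : MeasAlg m // ∃ S : Setoid X, IsBorelSubrelation S R ∧ Represents S a}

/-- The number of `S`-classes contained in the `R`-class of `x` (for `S ⊆ R`). -/
noncomputable def indexAt (S R : Setoid X) (x : X) : ℕ∞ :=
  {C : Set X | ∃ y, R x y ∧ C = {z | S y z}}.encard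

/-- The finite index subequivalence relations: almost every `R`-class is a finite union of
`S`-classes. -/
def SubFiniteIndex [MeasurableSpace X] (R : Setoid X) (μ : Measure X) (m : Measure (X × X)) :
    Set (Sub R m) :=
  {a | ∃ S : Setoid X, IsBorelSubrelation S R ∧ Represents S a.1 ∧ ∀ᵐ x ∂μ, indexAt S R x < ⊤}

/-- The subequivalence relations of index at most `k`: almost every `R`-class is a union of at most
`k` classes of `S`. -/
def SubIndexLE [MeasurableSpace X] (R : Setoid X) (μ : Measure X) (m : Measure (X × X)) (k : ℕ) :
    Set (Sub R m) :=
  {a | ∃ S : Setoid X, IsBorelSubrelation S R ∧ Represents S a.1 ∧ ∀ᵐ x ∂μ, indexAt S R x ≤ k}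

end SubRel

/-! The class-enumerating maps `T n` turn statements about almost every pair in `R` into statements
about all pairs in almost every class. Index at most `k` says that among any `k + 1` points of a
class two are `S`-related. A condition on finitely many pairs survives limits: a sequence converging
fast in `d_m` eventually agrees with its limit on any given finite set of pairs, by Borel–Cantelli.
This gives closedness (`isClosed_subIndexLE`). The index is constant on classes, so on an ergodic
component it is bounded once it is finite; with finitely many components the finite index relations
are the union of the closed sets `SubIndexLE R μ m k`, hence `F_σ`.

For hardness, aperiodicity provides a measurable `ℓ : X → ℕ` such that almost every class meets all
but finitely many levels (`exists_cofinite_level`). Given a set of levels, split each of them off as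
a separate subclass and merge the others: the index is finite exactly when the set is finite. The
set of finite subsets of `ℕ` is `F_σ`-hard (`exists_continuous_finite`). If there are infinitely
many ergodic components, `X` has infinitely many invariant pieces of positive measure
(`exists_partition`); choosing a set of levels independently on each piece encodes a countable
intersection of `F_σ` conditions. Conversely, an `F_σ` set cannot be `F_σδ`-hard, by Baire category.
-/

namespace SubRel

/-! ### Index of a subrelation, enumeration of classes, closedness of bounded index. -/

variable {X : Type*} {R S S' : Setoid X}

theorem indexAt_congr {x y : X} (h : R x y) : indexAt S R x = indexAt S R y := by
  have : ∀ z, R x z ↔ R y z := fun z => ⟨R.trans (R.symm h), R.trans h⟩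
  simp only [indexAt, this]

theorem indexAt_congr_setoid {x : X} (hS : ∀ x y, S x y → R x y) (hS' : ∀ x y, S' x y → R x y)
    (h : ∀ y z, R x y → R x z → (S y z ↔ S' y z)) : indexAt S R x = indexAt S' R x := by
  have : ∀ y, R x y → {z | S y z} = {z | S' y z} := by
    intro y hy
    ext z
    exact ⟨fun hz => (h y z hy (R.trans hy (hS _ _ hz))).1 hz,
      fun hz => (h y z hy (R.trans hy (hS' _ _ hz))).2 hz⟩
  unfold indexAt
  congr 1
  ext C
  exact exists_congr fun y => and_congr_right fun hy => by rw [this y hy]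

theorem setOf_rel_eq_iff {y z : X} : {w | S y w} = {w | S z w} ↔ S y z := by
  constructor
  · intro h
    have : z ∈ {w | S y w} := h ▸ S.refl z
    exact this
  · intro h
    ext w
    exact ⟨S.trans (S.symm h), S.trans h⟩

/-- Pigeonhole. This form only tests `S` on finitely many pairs at a time, which is what makes the
condition measurable in `x` and stable under limits in `S`. -/
theorem indexAt_le_iff {k : ℕ} {x : X} : indexAt S R x ≤ k ↔
    ∀ g : Fin (k + 1) → X, (∀ i, R x (g i)) → ∃ i j, i ≠ j ∧ S (g i) (g j) := by
  constructor
  · intro h g hg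
    by_contra! hne
    have hinj : Function.Injective fun i => {z | S (g i) z} := by
      intro i j hij
      by_contra hij'
      exact hne i j hij' (setOf_rel_eq_iff.1 hij)
    have h1 : range (fun i => {z | S (g i) z}) ⊆ {C : Set X | ∃ y, R x y ∧ C = {z | S y z}} := by
      rintro _ ⟨i, rfl⟩
      exact ⟨g i, hg i, rfl⟩
    have h2 := (encard_le_encard h1).trans h
    rw [← image_univ, hinj.encard_image, encard_univ, ENat.card_eq_coe_fintype_card,
      Fintype.card_fin] at h2
    exact absurd (Nat.cast_le.1 h2) (by omega)
  · intro h
    by_contra! hk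
    have hk' : ((k + 1 : ℕ) : ℕ∞) ≤ indexAt S R x := by
      push_cast
      exact Order.add_one_le_of_lt hk
    obtain ⟨t, ht, htc⟩ := exists_subset_encard_eq hk'
    have htf : t.Finite := finite_of_encard_eq_coe htc
    have hcard : Nat.card t = k + 1 := by
      rw [Nat.card_coe_set_eq, ncard, htc]
      rfl
    have : Finite t := htf
    let e : Fin (k + 1) ≃ t := (finCongr hcard.symm).trans (Finite.equivFin t).symm
    choose g hg hgC using fun i => ht (e i).2
    obtain ⟨i, j, hij, hS⟩ := h g hg
    refine hij (e.injective (Subtype.ext ?_))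
    rw [hgC i, hgC j]
    exact setOf_rel_eq_iff.2 hS

variable [MeasurableSpace X] {μ : Measure X} {m : Measure (X × X)} {T : ℕ → X → X}

/-- `T` is a sequence of non-singular maps which enumerates the classes of `R`. -/
structure IsEnumeration (R : Setoid X) (μ : Measure X) (T : ℕ → X → X) : Prop where
  quasi : ∀ n, Measure.QuasiMeasurePreserving (T n) μ μ
  rel_iff : ∀ x y, R x y ↔ ∃ n, T n x = y

theorem IsNonsingular.exists_isEnumeration (hR : IsNonsingular R μ) :
    ∃ T : ℕ → X → X, IsEnumeration R μ T := by
  obtain ⟨Γ, _, _, _, hmeas, hns, rfl⟩ := hR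
  obtain ⟨e, he⟩ := exists_surjective_nat Γ
  refine ⟨fun n x => e n • x, fun n => ⟨hmeas _, ?_⟩, fun x y => ?_⟩
  · refine Measure.AbsolutelyContinuous.mk fun A hA h0 => ?_
    rw [Measure.map_apply (hmeas _) hA]
    -- Non-singularity is stated for images, so the preimage is rewritten as an image under the
    -- inverse element.
    have : (fun x : X => e n • x) ⁻¹' A = (fun x => (e n)⁻¹ • x) '' A := by
      ext x
      simp only [mem_preimage, mem_image]
      constructor
      · intro h
        exact ⟨_, h, by simp⟩
      · rintro ⟨y, hy, rfl⟩
        simpa using hy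
    rw [this]
    exact (hns _ A hA).1 h0
  · rw [Setoid.comm']
    constructor
    · rintro ⟨γ, hγ⟩
      obtain ⟨n, rfl⟩ := he γ
      exact ⟨n, hγ⟩
    · rintro ⟨n, hn⟩
      exact ⟨e n, hn⟩

namespace IsEnumeration

theorem measurable (hT : IsEnumeration R μ T) (n : ℕ) : Measurable (T n) :=
  (hT.quasi n).measurable

theorem rel (hT : IsEnumeration R μ T) (n : ℕ) (x : X) : R x (T n x) :=
  (hT.rel_iff _ _).2 ⟨n, rfl⟩

theorem forall_rel_iff (hT : IsEnumeration R μ T) {P : X → Prop} {x : X} :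
    (∀ y, R x y → P y) ↔ ∀ n, P (T n x) := by
  constructor
  · exact fun h n => h _ (hT.rel n x)
  · intro h y hy
    obtain ⟨n, rfl⟩ := (hT.rel_iff _ _).1 hy
    exact h n

theorem exists_rel_iff (hT : IsEnumeration R μ T) {P : X → Prop} {x : X} :
    (∃ y, R x y ∧ P y) ↔ ∃ n, P (T n x) := by
  constructor
  · rintro ⟨y, hy, h⟩
    obtain ⟨n, rfl⟩ := (hT.rel_iff _ _).1 hy
    exact ⟨n, h⟩
  · rintro ⟨n, h⟩
    exact ⟨_, hT.rel n x, h⟩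

theorem ae_forall_rel (hT : IsEnumeration R μ T) {P : X → Prop} (h : ∀ᵐ x ∂μ, P x) :
    ∀ᵐ x ∂μ, ∀ y, R x y → P y := by
  simp_rw [hT.forall_rel_iff]
  exact ae_all_iff.2 fun n => (hT.quasi n).ae h

theorem measurableSet_graph [StandardBorelSpace X] (hT : IsEnumeration R μ T) :
    MeasurableSet (graph R) := by
  have : graph R = ⋃ n, {p : X × X | T n p.1 = p.2} := by
    ext p
    simp [graph, hT.rel_iff]
  rw [this]
  exact MeasurableSet.iUnion fun n =>
    measurableSet_eq_fun ((hT.measurable n).comp measurable_fst) measurable_snd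

/-- A property of almost every pair holds for all pairs in almost every class. -/
theorem ae_forall_pair [StandardBorelSpace X] (hT : IsEnumeration R μ T)
    (hm : IsEquivLeftMeasure R μ m) {P : X × X → Prop} (h : ∀ᵐ p ∂m, P p) :
    ∀ᵐ x ∂μ, ∀ y z, R x y → R x z → P (y, z) := by
  let A := toMeasurable m {p | ¬ P p} ∩ graph R
  have hA : MeasurableSet A := (measurableSet_toMeasurable _ _).inter hT.measurableSet_graph
  have hA0 : leftMeasure μ A = 0 := by
    rw [← hm.2 A inter_subset_right hA]
    refine measure_mono_null inter_subset_left ?_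
    rw [measure_toMeasurable]
    exact h
  have key : ∀ᵐ x ∂μ, ∀ z, R x z → P (x, z) := by
    simp_rw [hT.forall_rel_iff]
    refine ae_all_iff.2 fun n => ?_
    have hS : MeasurableSet {x | (x, T n x) ∈ A} := (measurable_id.prodMk (hT.measurable n)) hA
    -- The fibre of `A` above such an `x` contains `T n x`, so the left measure of `A` dominates the
    -- measure of this set.
    have h0 : μ {x | (x, T n x) ∈ A} = 0 := by
      refine le_antisymm ?_ zero_le
      rw [← hA0, ← lintegral_indicator_one hS]
      refine lintegral_mono fun x => ?_
      by_cases hx : (x, T n x) ∈ A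
      · rw [indicator_of_mem (by exact hx)]
        have : (1 : ℕ∞) ≤ {y | (x, y) ∈ A}.encard := one_le_encard_iff_nonempty.2 ⟨_, hx⟩
        simpa using (ENat.toENNReal_le.2 this)
      · rw [indicator_of_notMem (by exact hx)]
        exact zero_le
    refine measure_mono_null (fun x hx => ?_) h0
    exact ⟨subset_toMeasurable m {p | ¬ P p} hx, hT.rel n x⟩
  filter_upwards [hT.ae_forall_rel key] with x hx y z hy hz
  exact hx y hy z (R.trans (R.symm hy) hz)

end IsEnumeration

theorem IsEnumeration.indexAt_le_iff (hT : IsEnumeration R μ T) {k : ℕ} {x : X} :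
    indexAt S R x ≤ k ↔
      ∀ g : Fin (k + 1) → ℕ, ∃ i j, i ≠ j ∧ (T (g i) x, T (g j) x) ∈ graph S := by
  rw [SubRel.indexAt_le_iff]
  constructor
  · intro h g
    exact h _ fun i => hT.rel _ _
  · intro h g hg
    choose n hn using fun i => (hT.rel_iff _ _).1 (hg i)
    obtain ⟨i, j, hij, hS⟩ := h n
    exact ⟨i, j, hij, by rw [← hn i, ← hn j]; exact hS⟩

theorem IsEnumeration.measurableSet_indexAt_le (hT : IsEnumeration R μ T)
    (hS : MeasurableSet (graph S)) (k : ℕ) : MeasurableSet {x | indexAt S R x ≤ k} := by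
  have : {x | indexAt S R x ≤ k} = ⋂ g : Fin (k + 1) → ℕ, ⋃ (i) (j) (_ : i ≠ j),
      (fun x => (T (g i) x, T (g j) x)) ⁻¹' graph S := by
    ext x
    simp [hT.indexAt_le_iff]
  rw [this]
  exact MeasurableSet.iInter fun g => MeasurableSet.iUnion fun i => MeasurableSet.iUnion fun j =>
    MeasurableSet.iUnion fun _ => ((hT.measurable _).prodMk (hT.measurable _)) hS

theorem measure_symmDiff_eq_edist {a b : MeasAlg m} (ha : Represents S a) (hb : Represents S' b) :
    m (symmDiff (graph S) (graph S')) = edist a b := by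
  obtain ⟨h, rfl⟩ := ha
  obtain ⟨h', rfl⟩ := hb
  exact (SeparationQuotient.edist_mk (X := MeasuredSets m) ⟨_, h⟩ ⟨_, h'⟩).symm

/-- Two representatives of one point of `Sub R m` agree on all pairs in almost every class. Hence
the existential in `SubFiniteIndex` can be tested on any representative. -/
theorem IsEnumeration.ae_indexAt_eq [StandardBorelSpace X] (hT : IsEnumeration R μ T)
    (hm : IsEquivLeftMeasure R μ m) (hS : IsBorelSubrelation S R) (hS' : IsBorelSubrelation S' R)
    {a : MeasAlg m} (ha : Represents S a) (ha' : Represents S' a) :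
    ∀ᵐ x ∂μ, indexAt S R x = indexAt S' R x := by
  have h0 : m (symmDiff (graph S) (graph S')) = 0 := by
    rw [measure_symmDiff_eq_edist ha ha', edist_self]
  have h1 : ∀ᵐ p ∂m, p ∉ symmDiff (graph S) (graph S') := measure_eq_zero_iff_ae_notMem.1 h0
  filter_upwards [hT.ae_forall_pair hm h1] with x hx
  refine indexAt_congr_setoid hS.2 hS'.2 fun y z hy hz => ?_
  have := hx y z hy hz
  simp only [mem_symmDiff, graph, mem_ofPred_eq] at this
  tauto

theorem IsEnumeration.mem_subFiniteIndex_iff [StandardBorelSpace X] (hT : IsEnumeration R μ T)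
    (hm : IsEquivLeftMeasure R μ m) (hS : IsBorelSubrelation S R) {a : Sub R m}
    (ha : Represents S a.1) : a ∈ SubFiniteIndex R μ m ↔ ∀ᵐ x ∂μ, indexAt S R x < ⊤ := by
  constructor
  · rintro ⟨S', hS', ha', h⟩
    filter_upwards [h, hT.ae_indexAt_eq hm hS hS' ha ha'] with x hx hx'
    rwa [hx']
  · exact fun h => ⟨S, hS, ha, h⟩

/-- The relations of index at most `k` form a closed set. -/
theorem IsEnumeration.isClosed_subIndexLE [StandardBorelSpace X] (hT : IsEnumeration R μ T)
    (hm : IsEquivLeftMeasure R μ m) (k : ℕ) : IsClosed (SubIndexLE R μ m k) := by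
  refine IsSeqClosed.isClosed fun u a hu hlim => ?_
  choose S hS hSu hidx using hu
  obtain ⟨S₀, hS₀, hSa⟩ := a.2
  have hlim' : Filter.Tendsto (fun n => m (symmDiff (graph (S n)) (graph S₀))) Filter.atTop
      (nhds 0) := by
    have := tendsto_iff_edist_tendsto_0.1 hlim
    refine this.congr fun n => ?_
    rw [measure_symmDiff_eq_edist (hSu n) hSa]
    rfl
  obtain ⟨ε, hε, hsum⟩ := ENNReal.exists_pos_sum_of_countable' (ε := 1) one_ne_zero ℕ
  -- Choosing terms at summable distances from the limit upgrades convergence in measure to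
  -- convergence at almost every pair.
  have hex : ∀ j, ∃ n, m (symmDiff (graph (S n)) (graph S₀)) < ε j := fun j =>
    (hlim'.eventually_lt_const (hε j)).exists
  choose n hn using hex
  have h0 : ∀ᵐ p ∂m, ∀ᶠ j in Filter.atTop, p ∉ symmDiff (graph (S (n j))) (graph S₀) :=
    ae_eventually_notMem (((ENNReal.tsum_le_tsum fun j => (hn j).le).trans_lt
      (hsum.trans ENNReal.one_lt_top)).ne)
  refine ⟨S₀, hS₀, hSa, ?_⟩
  filter_upwards [hT.ae_forall_pair hm h0, ae_all_iff.2 fun j => hidx (n j)] with x hx hx'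
  rw [SubRel.indexAt_le_iff]
  intro g hg
  have hev : ∀ᶠ j in Filter.atTop, ∀ i i', (g i, g i') ∉ symmDiff (graph (S (n j))) (graph S₀) :=
    Filter.eventually_all.2 fun i => Filter.eventually_all.2 fun i' => hx _ _ (hg i) (hg i')
  obtain ⟨j, hj⟩ := hev.exists
  obtain ⟨i, i', hii, h⟩ := SubRel.indexAt_le_iff.1 (hx' j) g hg
  refine ⟨i, i', hii, ?_⟩
  have := hj i i'
  simp only [mem_symmDiff, graph, mem_ofPred_eq] at this
  tauto

/-- The sets where the index is at most `k` are invariant. By ergodicity each is null or conull in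
`A`, and they cannot all be null because they cover almost all of `A`. -/
theorem IsErgodicComponent.exists_ae_indexAt_le (hT : IsEnumeration R μ T)
    (hS : MeasurableSet (graph S)) (h : ∀ᵐ x ∂μ, indexAt S R x < ⊤) {A : Set X}
    (hA : IsErgodicComponent R μ A) : ∃ k : ℕ, ∀ᵐ x ∂μ, x ∈ A → indexAt S R x ≤ k := by
  obtain ⟨hAm, hAi, hA0, herg⟩ := hA
  by_contra hk
  have hnull : ∀ k : ℕ, μ (A ∩ {x | indexAt S R x ≤ k}) = 0 := by
    intro k
    refine (herg _ inter_subset_left (hAm.inter (hT.measurableSet_indexAt_le hS k)) ?_).resolve_right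
      fun h0 => hk ⟨k, ?_⟩
    · intro x y hxy
      simp only [mem_inter_iff, mem_ofPred_eq, indexAt_congr hxy, hAi x y hxy]
    · filter_upwards [measure_eq_zero_iff_ae_notMem.1 h0] with x hx hxA
      by_contra hx'
      exact hx ⟨hxA, fun h => hx' h.2⟩
  refine hA0 (measure_eq_zero_iff_ae_notMem.2 ?_)
  filter_upwards [h, ae_all_iff.2 fun k => measure_eq_zero_iff_ae_notMem.1 (hnull k)]
    with x hx hx' hxA
  obtain ⟨k, hk⟩ := ENat.ne_top_iff_exists.1 hx.ne
  exact hx' k ⟨hxA, hk.ge⟩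

theorem IsEnumeration.isFsigma_subFiniteIndex [StandardBorelSpace X] (hT : IsEnumeration R μ T)
    (hm : IsEquivLeftMeasure R μ m) (hfin : HasFinitelyManyErgodicComponents R μ) :
    IsFsigma (SubFiniteIndex R μ m) := by
  refine ⟨SubIndexLE R μ m, hT.isClosed_subIndexLE hm, ?_⟩
  ext a
  simp only [mem_iUnion]
  constructor
  · rintro ⟨S, hS, ha, h⟩
    obtain ⟨n, A, hA, -, hAu⟩ := hfin
    choose k hk using fun i => (hA i).exists_ae_indexAt_le hT hS.1 h
    refine ⟨Finset.univ.sup k, S, hS, ha, ?_⟩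
    filter_upwards [ae_all_iff.2 hk] with x hx
    obtain ⟨i, hi⟩ := mem_iUnion.1 (hAu.symm ▸ mem_univ x : x ∈ ⋃ i, A i)
    exact (hx i hi).trans (Nat.cast_le.2 (Finset.le_sup (Finset.mem_univ i)))
  · rintro ⟨k, S, hS, ha, h⟩
    refine ⟨S, hS, ha, ?_⟩
    filter_upwards [h] with x hx
    exact hx.trans_lt (ENat.natCast_lt_top k)

end SubRel

/-! ### Levels met by almost every class of an aperiodic relation. -/

namespace SubRel

variable {X : Type*} {R : Setoid X}

open Classical in
/-- The smallest accumulation point of the values of `φ` on the class of `x`. -/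
noncomputable def minAccPt (R : Setoid X) (φ : X → ℝ) (x : X) : ℝ :=
  -- The default `2` is an upper bound for the functions `φ` used below, so it does not affect the
  -- infimum on infinite classes.
  ⨅ q : ℚ, if {y | R x y ∧ φ y < q}.Infinite then (q : ℝ) else 2

theorem minAccPt_congr {φ : X → ℝ} {x y : X} (h : R x y) : minAccPt R φ x = minAccPt R φ y := by
  have : ∀ z, R x z ↔ R y z := fun z => ⟨R.trans (R.symm h), R.trans h⟩
  classical
  exact iInf_congr fun q => if_congr (by simp only [this]) rfl rfl

/-- On an infinite class, `φ` takes values different from its smallest accumulation point but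
arbitrarily close to it. -/
theorem exists_near_minAccPt {φ : X → ℝ} (hinj : Function.Injective φ)
    (hb : ∀ x, -2 < φ x ∧ φ x < 2) {x : X} (hx : {y | R x y}.Infinite) {ε : ℝ} (hε : 0 < ε) :
    ∃ y, R x y ∧ φ y ≠ minAccPt R φ x ∧ |φ y - minAccPt R φ x| < ε := by
  classical
  have hbdd : BddBelow (range fun q : ℚ =>
      if {y | R x y ∧ φ y < q}.Infinite then (q : ℝ) else 2) := by
    refine ⟨-2, ?_⟩
    rintro _ ⟨q, rfl⟩
    dsimp only
    split_ifs with h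
    · obtain ⟨y, -, hy⟩ := h.nonempty
      exact ((hb y).1.trans hy).le
    · norm_num
  set t := minAccPt R φ x with ht
  have hinf : {y | R x y ∧ φ y < t + ε}.Infinite := by
    obtain ⟨q, hq⟩ := exists_lt_of_ciInf_lt (show minAccPt R φ x < t + ε by linarith)
    split_ifs at hq with h
    · exact h.mono fun y hy => ⟨hy.1, hy.2.trans hq⟩
    · exact hx.mono fun y hy => ⟨hy, (hb y).2.trans hq⟩
  obtain ⟨q, hq, hqt⟩ := exists_rat_btwn (show t - ε < t by linarith)
  have hfin : {y | R x y ∧ φ y < q}.Finite := by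
    by_contra h
    have h1 := ciInf_le hbdd q
    rw [if_pos (show Set.Infinite _ from h)] at h1
    exact absurd hqt (not_lt.2 h1)
  have hsub : {y | φ y = t}.Finite :=
    Set.Subsingleton.finite fun y hy z hz => hinj (hy.trans hz.symm)
  obtain ⟨y, ⟨hy, hyt⟩, hyn⟩ := hinf.exists_notMem_finite (hfin.union hsub)
  simp only [mem_union, mem_ofPred_eq, not_or, not_and, not_lt] at hyn
  exact ⟨y, hy, hyn.2, abs_lt.2 ⟨by linarith [hyn.1 hy], by linarith⟩⟩

variable [MeasurableSpace X] {μ : Measure X} {T : ℕ → X → X}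

/-- Expresses infinitude by countable quantifiers over indices, from which measurability can be read
off. -/
theorem IsEnumeration.infinite_iff (hT : IsEnumeration R μ T) {B : Set X} {x : X} :
    {y | R x y ∧ y ∈ B}.Infinite ↔ ∀ n, ∃ k, T k x ∈ B ∧ ∀ i < n, T k x ≠ T i x := by
  constructor
  · intro h n
    obtain ⟨y, ⟨hy, hyB⟩, hyn⟩ := h.exists_notMem_finite ((finite_lt_nat n).image fun i => T i x)
    obtain ⟨k, rfl⟩ := (hT.rel_iff _ _).1 hy
    exact ⟨k, hyB, fun i hi he => hyn ⟨i, hi, he.symm⟩⟩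
  · intro h hfin
    choose! i hi using fun y => (hT.rel_iff x y).1
    obtain ⟨n, hn⟩ := (hfin.image i).bddAbove
    obtain ⟨k, hk, hne⟩ := h (n + 1)
    have hmem : T k x ∈ {y | R x y ∧ y ∈ B} := ⟨hT.rel k x, hk⟩
    exact hne _ (Nat.lt_succ_of_le (hn (mem_image_of_mem i hmem))) (hi _ hmem.1).symm

theorem IsEnumeration.measurableSet_infinite [StandardBorelSpace X] (hT : IsEnumeration R μ T)
    {B : Set X} (hB : MeasurableSet B) : MeasurableSet {x | {y | R x y ∧ y ∈ B}.Infinite} := by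
  have : {x | {y | R x y ∧ y ∈ B}.Infinite} =
      ⋂ n, ⋃ k, T k ⁻¹' B ∩ ⋂ (i) (_ : i < n), {x | T k x = T i x}ᶜ := by
    ext x
    simp only [mem_ofPred_eq, hT.infinite_iff, mem_iInter, mem_iUnion, mem_inter_iff, mem_preimage,
      mem_compl_iff, ne_eq]
  rw [this]
  exact MeasurableSet.iInter fun n => MeasurableSet.iUnion fun k => (hT.measurable k hB).inter <|
    MeasurableSet.iInter fun i => MeasurableSet.iInter fun _ =>
      (measurableSet_eq_fun (hT.measurable k) (hT.measurable i)).compl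

theorem exists_measurable_injective_bounded (X : Type*) [MeasurableSpace X]
    [StandardBorelSpace X] :
    ∃ φ : X → ℝ, Measurable φ ∧ Function.Injective φ ∧ ∀ x, -2 < φ x ∧ φ x < 2 := by
  obtain ⟨f, hf⟩ := exists_measurableEmbedding_real X
  refine ⟨fun x => Real.arctan (f x), Real.measurable_arctan.comp hf.measurable,
    Real.arctan_injective.comp hf.injective, fun x => ⟨?_, ?_⟩⟩
  · linarith [Real.neg_pi_div_two_lt_arctan (f x), Real.pi_lt_four]
  · linarith [Real.arctan_lt_pi_div_two (f x), Real.pi_lt_four]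

theorem IsEnumeration.measurable_minAccPt [StandardBorelSpace X] (hT : IsEnumeration R μ T)
    {φ : X → ℝ} (hφ : Measurable φ) : Measurable (minAccPt R φ) := by
  refine Measurable.iInf fun q => ?_
  exact Measurable.ite (hT.measurableSet_infinite (measurableSet_lt hφ measurable_const))
    measurable_const measurable_const

/-- The level is the integer part of the inverse distance from `φ` to its smallest accumulation
point on the class. It is unbounded since `φ` comes arbitrarily close to that point without
equalling it; where equality does hold, the level is `0` because `0⁻¹ = 0`. -/
theorem IsEnumeration.exists_unbounded_level [StandardBorelSpace X] (hT : IsEnumeration R μ T)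
    (hap : IsAperiodic R μ) :
    ∃ ℓ : X → ℕ, Measurable ℓ ∧ ∀ᵐ x ∂μ, ∀ n, ∃ y, R x y ∧ n ≤ ℓ y := by
  obtain ⟨φ, hφ, hinj, hb⟩ := exists_measurable_injective_bounded X
  refine ⟨fun y => ⌊|φ y - minAccPt R φ y|⁻¹⌋₊,
    (hφ.sub (hT.measurable_minAccPt hφ)).abs.inv.nat_floor, ?_⟩
  filter_upwards [hap] with x hx n
  have hn : (0 : ℝ) < n + 1 := by positivity
  obtain ⟨y, hy, hne, hlt⟩ := exists_near_minAccPt hinj hb hx (inv_pos.2 hn)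
  refine ⟨y, hy, Nat.le_floor ?_⟩
  rw [← minAccPt_congr hy]
  have h0 : 0 < |φ y - minAccPt R φ x| := abs_pos.2 (sub_ne_zero.2 hne)
  have := (lt_inv_comm₀ h0 hn).1 hlt
  linarith

/-- A strictly increasing sequence of natural numbers cuts `ℕ` into consecutive blocks. -/
theorem exists_blockIndex {N : ℕ → ℕ} (hN : StrictMono N) :
    ∃ h : ℕ → ℕ, ∀ k n, N k ≤ n → n < N (k + 1) → h n = k := by
  have hex : ∀ n, ∃ k, n < N (k + 1) := fun n => ⟨n, hN.id_le (n + 1)⟩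
  classical
  refine ⟨fun n => Nat.find (hex n), fun k n h1 h2 => (Nat.find_eq_iff _).2 ⟨h2, fun j hj => ?_⟩⟩
  exact not_lt.2 ((hN.monotone (Nat.succ_le_of_lt hj)).trans h1)

/-- In an aperiodic relation there is a measurable partition such that almost every class meets
all but finitely many of the pieces. -/
theorem IsEnumeration.exists_cofinite_level [StandardBorelSpace X] [IsFiniteMeasure μ]
    (hT : IsEnumeration R μ T) (hap : IsAperiodic R μ) :
    ∃ ℓ : X → ℕ, Measurable ℓ ∧
      ∀ᵐ x ∂μ, ∀ᶠ k in Filter.atTop, ∃ y, R x y ∧ ℓ y = k := by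
  obtain ⟨ℓ, hℓ, hunb⟩ := hT.exists_unbounded_level hap
  obtain ⟨ε, hε, hsum⟩ := ENNReal.exists_pos_sum_of_countable' (ε := 1) one_ne_zero ℕ
  let D : ℕ → ℕ → Set X := fun N N' => {x | ¬ ∃ y, R x y ∧ N ≤ ℓ y ∧ ℓ y < N'}
  have hD : ∀ N N', MeasurableSet (D N N') := by
    intro N N'
    have : D N N' = (⋃ k, T k ⁻¹' (ℓ ⁻¹' Ico N N'))ᶜ := by
      ext x
      simp only [D, mem_ofPred_eq, hT.exists_rel_iff, mem_compl_iff, mem_iUnion, mem_preimage,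
        mem_Ico]
    rw [this]
    exact (MeasurableSet.iUnion fun k =>
      hT.measurable k (hℓ (MeasurableSet.of_discrete))).compl
  have hlim : ∀ N, Filter.Tendsto (fun N' => μ (D N N')) Filter.atTop (nhds 0) := by
    intro N
    have h0 : μ (⋂ N', D N N') = 0 := by
      refine measure_eq_zero_iff_ae_notMem.2 ?_
      filter_upwards [hunb] with x hx hx'
      obtain ⟨y, hy, hN⟩ := hx N
      exact mem_iInter.1 hx' (ℓ y + 1) ⟨y, hy, hN, Nat.lt_succ_self _⟩
    rw [← h0]
    refine tendsto_measure_iInter_atTop (fun N' => (hD N N').nullMeasurableSet) ?_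
      ⟨0, measure_ne_top _ _⟩
    exact fun a b hab x hx ⟨y, hy, h1, h2⟩ => hx ⟨y, hy, h1, h2.trans_le hab⟩
  -- Unbounded levels are grouped into blocks so long that the points whose class misses block `k`
  -- have measure below `ε k`. By Borel–Cantelli almost every class misses only finitely many
  -- blocks, and the blocks become the new levels.
  have hex : ∀ k N, ∃ N', N < N' ∧ μ (D N N') < ε k := fun k N =>
    ((Filter.eventually_gt_atTop N).and ((hlim N).eventually_lt_const (hε k))).exists
  choose F hF hFμ using hex
  let N : ℕ → ℕ := fun k => Nat.rec 0 F k
  have hN : StrictMono N := strictMono_nat_of_lt_succ fun k => hF k (N k)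
  obtain ⟨h, hh⟩ := exists_blockIndex hN
  refine ⟨h ∘ ℓ, (measurable_of_countable h).comp hℓ, ?_⟩
  have hae : ∀ᵐ x ∂μ, ∀ᶠ k in Filter.atTop, x ∉ D (N k) (N (k + 1)) :=
    ae_eventually_notMem (((ENNReal.tsum_le_tsum fun k => (hFμ k (N k)).le).trans_lt
      (hsum.trans ENNReal.one_lt_top)).ne)
  filter_upwards [hae] with x hx
  filter_upwards [hx] with k hk
  obtain ⟨y, hy, h1, h2⟩ := not_not.1 hk
  exact ⟨y, hy, hh k _ h1 h2⟩

end SubRel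

/-! ### Subrelations defined by colourings, continuously in a Boolean matrix. -/

namespace SubRel

variable {X : Type*}

/-- The subrelation of `R` whose classes are the intersections of the classes of `R` with the
level sets of `c`. -/
def colourRel (R : Setoid X) (c : X → ℕ) : Setoid X := R ⊓ Setoid.ker c

theorem colourRel_iff {R : Setoid X} {c : X → ℕ} {x y : X} :
    colourRel R c x y ↔ R x y ∧ c x = c y := Iff.rfl

theorem indexAt_colourRel (R : Setoid X) (c : X → ℕ) (x : X) :
    indexAt (colourRel R c) R x = (c '' {y | R x y}).encard := by
  let D : ℕ → Set X := fun n => {z | R x z ∧ c z = n}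
  have hD : InjOn D (c '' {y | R x y}) := by
    rintro _ ⟨y, hy, rfl⟩ n - h
    have : y ∈ D n := h ▸ (⟨hy, rfl⟩ : y ∈ D (c y))
    exact this.2
  rw [← hD.encard_image, image_image, indexAt]
  congr 1
  ext C
  have : ∀ y, R x y → {z | colourRel R c y z} = D (c y) := by
    intro y hy
    ext z
    simp only [colourRel_iff, D, mem_ofPred_eq]
    exact and_congr ⟨R.trans hy, R.trans (R.symm hy)⟩ eq_comm
  constructor
  · rintro ⟨y, hy, rfl⟩
    exact ⟨y, hy, (this y hy).symm⟩
  · rintro ⟨y, hy, rfl⟩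
    exact ⟨y, hy, (this y hy).symm⟩

/-- The colouring by which each level `k` with `b (p x) k` is split off from the others. -/
def levelColour (p ℓ : X → ℕ) (b : ℕ → ℕ → Bool) (x : X) : ℕ :=
  -- The shift by one reserves colour `0` for all the merged levels.
  if b (p x) (ℓ x) then ℓ x + 1 else 0

theorem indexAt_levelColour_lt_top_iff {R : Setoid X} {p ℓ : X → ℕ}
    (hp : ∀ x y, R x y → p x = p y) {x : X}
    (hx : ∀ᶠ k in Filter.atTop, ∃ y, R x y ∧ ℓ y = k) (b : ℕ → ℕ → Bool) :
    indexAt (colourRel R (levelColour p ℓ b)) R x < ⊤ ↔ {k | b (p x) k = true}.Finite := by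
  rw [indexAt_colourRel, encard_lt_top_iff]
  constructor
  · intro h
    obtain ⟨n, hn⟩ := Filter.eventually_atTop.1 hx
    refine ((finite_lt_nat n).union (h.preimage (f := Nat.succ)
      Nat.succ_injective.injOn)).subset fun k hk => ?_
    rcases lt_or_ge k n with hkn | hkn
    · exact Or.inl hkn
    · obtain ⟨y, hy, rfl⟩ := hn k hkn
      refine Or.inr ⟨y, hy, ?_⟩
      have hk' : b (p x) (ℓ y) = true := hk
      rw [hp x y hy] at hk'
      simp [levelColour, hk']
  · intro h
    refine ((h.image Nat.succ).insert 0).subset ?_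
    rintro _ ⟨y, hy, rfl⟩
    unfold levelColour
    rw [← hp x y hy]
    split_ifs with hb
    · exact Or.inr ⟨ℓ y, hb, rfl⟩
    · exact Or.inl rfl

variable [MeasurableSpace X] {R : Setoid X} {μ : Measure X} {T : ℕ → X → X} {m : Measure (X × X)}

theorem IsEnumeration.isBorelSubrelation_colourRel [StandardBorelSpace X]
    (hT : IsEnumeration R μ T) {c : X → ℕ} (hc : Measurable c) :
    IsBorelSubrelation (colourRel R c) R :=
  ⟨hT.measurableSet_graph.inter (measurableSet_eq_fun (hc.comp measurable_fst)
    (hc.comp measurable_snd)), fun _ _ h => h.1⟩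

theorem measurable_levelColour {p ℓ : X → ℕ} (hp : Measurable p) (hℓ : Measurable ℓ)
    (b : ℕ → ℕ → Bool) : Measurable (levelColour p ℓ b) :=
  (measurable_of_countable fun q : ℕ × ℕ => if b q.1 q.2 then q.2 + 1 else 0).comp
    (hp.prodMk hℓ)

/-- The family of subrelations of `R` given by the level colourings. -/
noncomputable def levelSub [StandardBorelSpace X] (hT : IsEnumeration R μ T)
    (m : Measure (X × X)) {p ℓ : X → ℕ} (hp : Measurable p) (hℓ : Measurable ℓ)
    (b : ℕ → ℕ → Bool) : Sub R m :=
  have h := hT.isBorelSubrelation_colourRel (measurable_levelColour hp hℓ b)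
  ⟨SeparationQuotient.mk (X := MeasuredSets m) ⟨graph (colourRel R (levelColour p ℓ b)), h.1⟩,
    _, h, h.1, rfl⟩

theorem represents_levelSub [StandardBorelSpace X] (hT : IsEnumeration R μ T)
    {p ℓ : X → ℕ} (hp : Measurable p) (hℓ : Measurable ℓ) (b : ℕ → ℕ → Bool) :
    Represents (colourRel R (levelColour p ℓ b)) (levelSub hT m hp hℓ b).1 :=
  ⟨(hT.isBorelSubrelation_colourRel (measurable_levelColour hp hℓ b)).1, rfl⟩

/-- If two matrices agree on indices below `N`, the two relations differ only at pairs having a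
point with `p` or `ℓ` at least `N`. Those pairs have small measure for large `N`, as `m` is finite.
-/
theorem continuous_levelSub [StandardBorelSpace X] [IsFiniteMeasure m] (hT : IsEnumeration R μ T)
    {p ℓ : X → ℕ} (hp : Measurable p) (hℓ : Measurable ℓ) :
    Continuous (levelSub hT m hp hℓ) := by
  let q : X → ℕ := fun x => max (p x) (ℓ x)
  have hq : Measurable q := hp.max hℓ
  let D : ℕ → Set (X × X) := fun N => {z | N ≤ max (q z.1) (q z.2)}
  have hlim : Filter.Tendsto (fun N => m (D N)) Filter.atTop (nhds 0) := by
    have h0 : ⋂ N, D N = ∅ := by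
      refine eq_empty_of_forall_notMem fun z hz => ?_
      exact absurd (mem_iInter.1 hz (max (q z.1) (q z.2) + 1)) (Nat.not_succ_le_self _)
    rw [← measure_empty (μ := m), ← h0]
    refine tendsto_measure_iInter_atTop (fun N => ?_) (fun a b hab z hz => le_trans hab hz)
      ⟨0, measure_ne_top _ _⟩
    exact (measurableSet_le measurable_const
      ((hq.comp measurable_fst).max (hq.comp measurable_snd))).nullMeasurableSet
  refine Continuous.subtype_mk (continuous_iff_continuousAt.2 fun b => ?_) _
  refine tendsto_iff_edist_tendsto_0.2 (ENNReal.tendsto_nhds_zero.2 fun ε hε => ?_)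
  obtain ⟨N, hN⟩ := (hlim.eventually_lt_const hε).exists
  have hopen : ∀ᶠ b' in nhds b, ∀ i < N, ∀ j < N, b' i j = b i j := by
    refine (Filter.eventually_all_finite (finite_lt_nat N)).2 fun i _ =>
      (Filter.eventually_all_finite (finite_lt_nat N)).2 fun j _ => ?_
    have hc : Continuous fun b' : ℕ → ℕ → Bool => b' i j := by fun_prop
    exact (hc.tendsto b).eventually (IsOpen.mem_nhds (isOpen_discrete {b i j}) rfl)
  filter_upwards [hopen] with b' hb'
  refine le_trans ?_ hN.le
  refine (measure_symmDiff_eq_edist (represents_levelSub hT hp hℓ b')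
    (represents_levelSub hT hp hℓ b)).ge.trans (measure_mono fun z hz => ?_)
  by_contra hzN
  have hzN' : max (q z.1) (q z.2) < N := not_le.1 hzN
  have hcol : ∀ x, q x < N → levelColour p ℓ b' x = levelColour p ℓ b x := by
    intro x hx
    unfold levelColour
    rw [hb' _ (lt_of_le_of_lt (le_max_left _ _) hx) _ (lt_of_le_of_lt (le_max_right _ _) hx)]
  have h1 := hcol z.1 (lt_of_le_of_lt (le_max_left _ _) hzN')
  have h2 := hcol z.2 (lt_of_le_of_lt (le_max_right _ _) hzN')
  simp only [mem_symmDiff, graph, mem_ofPred_eq, colourRel_iff, h1, h2] at hz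
  tauto

/-- Since every nonempty fibre of `p` has positive measure, an almost everywhere condition depending
only on `p x` must hold at each value. Using `range p` covers both a constant `p` and a `p` onto
`ℕ`. -/
theorem levelSub_mem_subFiniteIndex_iff [StandardBorelSpace X] (hT : IsEnumeration R μ T)
    (hm : IsEquivLeftMeasure R μ m) {p ℓ : X → ℕ} (hp : Measurable p) (hℓ : Measurable ℓ)
    (hpR : ∀ x y, R x y → p x = p y)
    (hcof : ∀ᵐ x ∂μ, ∀ᶠ k in Filter.atTop, ∃ y, R x y ∧ ℓ y = k)
    (hpos : ∀ b : ℕ, b ∈ range p → μ (p ⁻¹' {b}) ≠ 0) (b : ℕ → ℕ → Bool) :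
    levelSub hT m hp hℓ b ∈ SubFiniteIndex R μ m ↔
      ∀ n ∈ range p, {k | b n k = true}.Finite := by
  rw [hT.mem_subFiniteIndex_iff hm
    (hT.isBorelSubrelation_colourRel (measurable_levelColour hp hℓ b))
    (represents_levelSub hT hp hℓ b)]
  constructor
  · intro h n hn
    by_contra hinf
    refine hpos n hn (measure_eq_zero_iff_ae_notMem.2 ?_)
    filter_upwards [h, hcof] with x hx hx' hxn
    rw [indexAt_levelColour_lt_top_iff hpR hx', show p x = n from hxn] at hx
    exact hinf hx
  · intro h
    filter_upwards [hcof] with x hx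
    exact (indexAt_levelColour_lt_top_iff hpR hx b).2 (h _ ⟨x, rfl⟩)

end SubRel

/-! ### Reductions and non-reductions between Borel classes. -/

namespace SubRel

theorem IsFsigma.preimage {Y Z : Type*} [TopologicalSpace Y] [TopologicalSpace Z] {A : Set Y}
    (hA : IsFsigma A) {f : Z → Y} (hf : Continuous f) : IsFsigma (f ⁻¹' A) := by
  obtain ⟨C, hC, rfl⟩ := hA
  exact ⟨fun n => f ⁻¹' C n, fun n => (hC n).preimage hf, preimage_iUnion⟩

theorem IsFsigma.exists_monotone {Y : Type*} [TopologicalSpace Y] {A : Set Y} (hA : IsFsigma A) :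
    ∃ C : ℕ → Set Y, (∀ n, IsClosed (C n)) ∧ Monotone C ∧ A = ⋃ n, C n := by
  obtain ⟨C, hC, rfl⟩ := hA
  refine ⟨accumulate C, fun n => ?_, monotone_accumulate, iUnion_accumulate.symm⟩
  exact (finite_le_nat n).isClosed_biUnion fun i _ => hC i

theorem IsZeroDimensional.exists_disjoint_clopen {Z : Type*} [TopologicalSpace Z]
    [SecondCountableTopology Z] (hZ : IsZeroDimensional Z) {U : Set Z} (hU : IsOpen U) :
    ∃ V : ℕ → Set Z, (∀ n, IsClopen (V n)) ∧ Pairwise (Function.onFun Disjoint V) ∧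
      ⋃ n, V n = U := by
  obtain ⟨𝒱, hV, hcl, hU'⟩ : ∃ 𝒱 : Set (Set Z), 𝒱.Countable ∧ (∀ V ∈ 𝒱, IsClopen V) ∧
      ⋃₀ 𝒱 = U := by
    obtain ⟨𝒱, h𝒱, rfl⟩ := TopologicalSpace.IsTopologicalBasis.open_eq_sUnion hZ hU
    obtain ⟨𝒲, h1, h2, h3⟩ := TopologicalSpace.isOpen_sUnion_countable 𝒱
      fun V hV => (h𝒱 hV : IsClopen V).isOpen
    exact ⟨𝒲, h1, fun V hV => h𝒱 (h2 hV), h3⟩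
  obtain ⟨W, hW⟩ := (hV.insert ∅).exists_eq_range (insert_nonempty _ _)
  have hWc : ∀ n, IsClopen (W n) := by
    intro n
    have : W n ∈ insert ∅ 𝒱 := hW ▸ mem_range_self n
    rcases this with h | h
    · exact h ▸ isClopen_empty
    · exact hcl _ h
  refine ⟨disjointed W, fun n => ?_, disjoint_disjointed W, ?_⟩
  · exact disjointedRec (fun _ i h => IsClopen.diff h (hWc i)) (hWc n)
  · rw [iUnion_disjointed, ← sUnion_range, ← hW, ← hU', sUnion_insert, empty_union]

open Classical in
/-- Every `F_σ` subset of a zero-dimensional Polish space is continuously reducible to the set of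
finite subsets of `ℕ`. -/
theorem IsFsigma.exists_continuous_finite {Z : Type*} [TopologicalSpace Z]
    [SecondCountableTopology Z] (hZ : IsZeroDimensional Z) {B : Set Z} (hB : IsFsigma B) :
    ∃ g : Z → ℕ → Bool, Continuous g ∧ ∀ z, z ∈ B ↔ {k | g z k = true}.Finite := by
  -- With `C` increasing, the complement of each `C n` is cut into disjoint clopen pieces `V n j`,
  -- and bit `Nat.pair n j` of `g z` records `z ∈ V n j`. Each `n` with `z ∉ C n` contributes
  -- exactly one true bit and the other `n` none, so finiteness means that `z` lies in some `C n`.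
  obtain ⟨C, hC, hmono, rfl⟩ := hB.exists_monotone
  choose V hVc hVd hVU using fun n => hZ.exists_disjoint_clopen (hC n).isOpen_compl
  refine ⟨fun z (k : ℕ) => decide (z ∈ V k.unpair.1 k.unpair.2), continuous_pi fun k => ?_, fun z => ?_⟩
  · refine (IsLocallyConstant.iff_isOpen_fiber.2 fun c => ?_).continuous
    cases c
    · convert (hVc k.unpair.1 k.unpair.2).compl.isOpen using 1
      ext z
      simp
    · convert (hVc k.unpair.1 k.unpair.2).isOpen using 1
      ext z
      simp
  simp only [decide_eq_true_eq]
  constructor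
  · intro hz
    obtain ⟨n, hn⟩ := mem_iUnion.1 hz
    have hlt : ∀ k : ℕ, z ∈ V k.unpair.1 k.unpair.2 → k.unpair.1 < n := by
      intro k hk
      by_contra! h
      exact (hVU _ ▸ mem_iUnion.2 ⟨_, hk⟩ : z ∈ (C k.unpair.1)ᶜ) (hmono h hn)
    refine Set.Finite.of_injOn (f := fun k : ℕ => k.unpair.1) (t := {i | i < n})
      (fun k hk => hlt k hk) ?_ (finite_lt_nat n)
    intro k hk k' hk' h
    have h' : k.unpair.1 = k'.unpair.1 := h
    have h2 : k.unpair.2 = k'.unpair.2 := by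
      by_contra hne
      have hk2 : z ∈ V k'.unpair.1 k.unpair.2 := h' ▸ hk
      exact disjoint_left.1 (hVd k'.unpair.1 hne) hk2 hk'
    exact Nat.pairEquiv.symm.injective (Prod.ext h' h2)
  · intro hfin
    by_contra hz
    have hz' : ∀ n, ∃ j, z ∈ V n j := by
      intro n
      rw [← mem_iUnion, hVU]
      exact fun h => hz (mem_iUnion.2 ⟨n, h⟩)
    choose j hj using hz'
    refine infinite_of_injective_forall_mem (f := fun n => Nat.pair n (j n)) ?_ ?_ hfin
    · intro n n' h
      exact (Nat.pair_eq_pair.1 h).1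
    · intro n
      simpa using hj n

theorem not_isOpen_singleton_cantor (d : ℕ → Bool) : ¬ IsOpen ({d} : Set (ℕ → Bool)) := by
  intro h
  obtain ⟨I, u, hu, hsub⟩ := isOpen_pi_iff.1 h d rfl
  obtain ⟨n, hn⟩ := Infinite.exists_notMem_finset I
  have : Function.update d n (!d n) ∈ ({d} : Set (ℕ → Bool)) := by
    refine hsub fun i hi => ?_
    rw [Function.update_of_ne (ne_of_mem_of_not_mem hi hn)]
    exact (hu i hi).2
  have := congrFun (this : Function.update d n (!d n) = d) n
  simp at this

/-- The example is the complement of a countable dense set. Were it `F_σ`, Cantor space would be a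
countable union of closed sets with empty interior: singletons, as there are no isolated points, and
closed sets missing a dense set. -/
theorem exists_isFsigmaDelta_not_isFsigma :
    ∃ B : Set (ℕ → Bool), IsFsigmaDelta B ∧ ¬ IsFsigma B := by
  obtain ⟨D, hDc, hDd⟩ := TopologicalSpace.exists_countable_dense (ℕ → Bool)
  obtain ⟨d, rfl⟩ := hDc.exists_eq_range hDd.nonempty
  refine ⟨(range d)ᶜ, ⟨fun n => {d n}ᶜ, fun n => ?_, ?_⟩, ?_⟩
  · let _ := TopologicalSpace.metrizableSpaceMetric (ℕ → Bool)
    obtain ⟨F, hF, -, hFU, -⟩ := (isOpen_compl_singleton (x := d n)).exists_iUnion_isClosed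
    exact ⟨F, hF, hFU.symm⟩
  · ext x
    simp [eq_comm]
  · rintro ⟨C, hC, hCU⟩
    have hcover : ⋃ s : ℕ ⊕ ℕ, Sum.elim (fun n => {d n}) C s = univ := by
      rw [iUnion_sum]
      simp only [Sum.elim_inl, Sum.elim_inr, ← hCU, iUnion_singleton_eq_range, union_compl_self]
    obtain ⟨s, hs⟩ := nonempty_interior_of_iUnion_of_closed
      (fun s => by cases s with
        | inl n => exact isClosed_singleton
        | inr n => exact hC n) hcover
    cases s with
    | inl n =>
      rw [Sum.elim_inl] at hs
      refine not_isOpen_singleton_cantor (d n) ?_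
      rcases subset_singleton_iff_eq.1 (interior_subset (s := {d n})) with h | h
      · rw [h] at hs
        exact absurd hs not_nonempty_empty
      · exact h ▸ isOpen_interior
    | inr n =>
      obtain ⟨y, hy, hyD⟩ := hDd.inter_open_nonempty _ isOpen_interior hs
      have : y ∈ (range d)ᶜ := hCU ▸ mem_iUnion.2 ⟨n, interior_subset hy⟩
      exact this hyD

theorem isZeroDimensional_cantor : IsZeroDimensional (ℕ → Bool) :=
  isTopologicalBasis_isClopen

/-- An `F_σ` set is not `F_σδ`-hard. -/
theorem IsFsigma.not_isFsigmaDeltaHard {Y : Type*} [TopologicalSpace Y] {A : Set Y}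
    (hA : IsFsigma A) : ¬ IsFsigmaDeltaHard A := by
  intro h
  obtain ⟨B, hB, hB'⟩ := exists_isFsigmaDelta_not_isFsigma
  have : TopologicalSpace.IsCompletelyMetrizableSpace (ℕ → Bool) := inferInstance
  obtain ⟨f, hf, rfl⟩ := h (ℕ → Bool) isZeroDimensional_cantor B hB
  exact hB' (hA.preimage hf)

end SubRel

/-! ### Infinite invariant partitions from infinitely many ergodic components. -/

namespace SubRel

variable {X : Type*} [MeasurableSpace X] {R : Setoid X} {μ : Measure X}

/-- `A` is a disjoint union of finitely many ergodic components. -/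
def IsFiniteErgodicUnion (R : Setoid X) (μ : Measure X) (A : Set X) : Prop :=
  ∃ 𝓕 : Set (Set X), 𝓕.Finite ∧ (∀ B ∈ 𝓕, IsErgodicComponent R μ B) ∧
    𝓕.PairwiseDisjoint id ∧ ⋃₀ 𝓕 = A

theorem IsErgodicComponent.isFiniteErgodicUnion {A : Set X} (hA : IsErgodicComponent R μ A) :
    IsFiniteErgodicUnion R μ A :=
  ⟨{A}, finite_singleton A, by simpa using hA, by simp, by simp⟩

theorem IsFiniteErgodicUnion.union {A B : Set X} (hA : IsFiniteErgodicUnion R μ A)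
    (hB : IsFiniteErgodicUnion R μ B) (hAB : Disjoint A B) :
    IsFiniteErgodicUnion R μ (A ∪ B) := by
  obtain ⟨𝓕, hf, he, hd, rfl⟩ := hA
  obtain ⟨𝓖, hf', he', hd', rfl⟩ := hB
  refine ⟨𝓕 ∪ 𝓖, hf.union hf', ?_, ?_, sUnion_union _ _⟩
  · rintro C (hC | hC)
    exacts [he C hC, he' C hC]
  · refine hd.union hd' fun C hC C' hC' _ => ?_
    exact hAB.mono (subset_sUnion_of_mem hC) (subset_sUnion_of_mem hC')

theorem IsFiniteErgodicUnion.hasFinitelyManyErgodicComponents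
    (h : IsFiniteErgodicUnion R μ univ) : HasFinitelyManyErgodicComponents R μ := by
  obtain ⟨𝓕, hf, he, hd, hU⟩ := h
  have : Finite 𝓕 := hf
  let e := Finite.equivFin 𝓕
  refine ⟨_, fun i => (e.symm i).1, fun i => he _ (e.symm i).2, fun i j hij => ?_, ?_⟩
  · exact hd (e.symm i).2 (e.symm j).2 fun h => hij (e.symm.injective (Subtype.ext h))
  · rw [← hU, sUnion_eq_iUnion]
    exact e.symm.surjective.iUnion_comp fun B : 𝓕 => B.1

/-- The invariant Borel sets which are not finite disjoint unions of ergodic components. -/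
def IsInfiniteInvariant (R : Setoid X) (μ : Measure X) (A : Set X) : Prop :=
  MeasurableSet A ∧ (∀ x y, R x y → (x ∈ A ↔ y ∈ A)) ∧ μ A ≠ 0 ∧ ¬ IsFiniteErgodicUnion R μ A

/-- Non-ergodicity splits `A` into two invariant sets of positive measure. They cannot both be
finite unions of components, so one of them can be kept and the other discarded. -/
theorem IsInfiniteInvariant.exists_subset {A : Set X} (hA : IsInfiniteInvariant R μ A) :
    ∃ B ⊆ A, IsInfiniteInvariant R μ B ∧ μ (A \ B) ≠ 0 := by
  obtain ⟨hAm, hAi, hA0, hAf⟩ := hA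
  have hne : ¬ IsErgodicComponent R μ A := fun h => hAf h.isFiniteErgodicUnion
  simp only [IsErgodicComponent, not_and, not_forall, not_or] at hne
  obtain ⟨B, hBA, hBm, hBi, hB0, hAB0⟩ := hne hAm hAi hA0
  by_cases hBf : IsFiniteErgodicUnion R μ B
  · refine ⟨A \ B, sdiff_subset, ⟨hAm.diff hBm, fun x y hxy => ?_, hAB0, fun hf => ?_⟩, ?_⟩
    · rw [mem_sdiff, mem_sdiff, hAi x y hxy, hBi x y hxy]
    · refine hAf ?_
      rw [← union_sdiff_cancel hBA]
      exact hBf.union hf disjoint_sdiff_right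
    · rwa [sdiff_sdiff_cancel_left hBA]
  · exact ⟨B, hBA, ⟨hBm, hBi, hB0, hBf⟩, hAB0⟩

/-- If `R` has infinitely many ergodic components, then `X` has an infinite partition into
invariant Borel sets of positive measure. -/
theorem HasInfinitelyManyErgodicComponents.exists_partition [NeZero μ]
    (h : HasInfinitelyManyErgodicComponents R μ) :
    ∃ p : X → ℕ, Measurable p ∧ (∀ x y, R x y → p x = p y) ∧ ∀ n, μ (p ⁻¹' {n}) ≠ 0 := by
  have huniv : IsInfiniteInvariant R μ univ :=
    ⟨MeasurableSet.univ, by simp, NeZero.ne _ ∘ Measure.measure_univ_eq_zero.1,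
      fun hf => h hf.hasFinitelyManyErgodicComponents⟩
  choose F hFsub hF hF0 using fun A : {A : Set X // IsInfiniteInvariant R μ A} => A.2.exists_subset
  let A : ℕ → {A : Set X // IsInfiniteInvariant R μ A} :=
    fun n => Nat.rec ⟨univ, huniv⟩ (fun _ B => ⟨F B, hF B⟩) n
  have hanti : Antitone fun n => (A n).1 := antitone_nat_of_succ_le fun n => hFsub (A n)
  classical
  -- `p x` is the stage at which `x` leaves the decreasing sequence `A`. Points that never leave get
  -- `0`, so only the fibre over `0` can exceed the corresponding difference set.
  let p : X → ℕ := fun x =>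
    if hx : ∃ n, x ∉ (A (n + 1)).1 then Nat.find hx else 0
  have hpR : ∀ x y, R x y → p x = p y := by
    intro x y hxy
    have : ∀ n, x ∉ (A (n + 1)).1 ↔ y ∉ (A (n + 1)).1 := fun n =>
      not_congr ((A (n + 1)).2.2.1 x y hxy)
    simp only [p, this]
  have hsub : ∀ n, (A n).1 \ (A (n + 1)).1 ⊆ p ⁻¹' {n} := by
    rintro n x ⟨h1, h2⟩
    have hx : ∃ n, x ∉ (A (n + 1)).1 := ⟨n, h2⟩
    simp only [mem_preimage, mem_singleton_iff, p, dif_pos hx]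
    exact (Nat.find_eq_iff hx).2 ⟨h2, fun j hj hx' => hx' (hanti (Nat.succ_le_of_lt hj) h1)⟩
  refine ⟨p, ?_, hpR, fun n h0 => hF0 (A n) (measure_mono_null (hsub n) h0)⟩
  have hA : ∀ n, MeasurableSet (A n).1 := fun n => (A n).2.1
  have hp : ∀ n, p ⁻¹' {n + 1} = (A (n + 1)).1 \ (A (n + 2)).1 := by
    intro n
    refine subset_antisymm (fun x hx => ?_) (hsub (n + 1))
    simp only [mem_preimage, mem_singleton_iff, p] at hx
    split_ifs at hx with hex
    obtain ⟨h1, h2⟩ := (Nat.find_eq_iff hex).1 hx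
    exact ⟨not_not.1 (h2 n (Nat.lt_succ_self n)), h1⟩
  have hp' : ∀ n, MeasurableSet (p ⁻¹' {n + 1}) := fun n => by
    rw [hp n]
    exact (hA (n + 1)).diff (hA (n + 2))
  refine measurable_to_countable' fun n => ?_
  cases n with
  | zero =>
    have : p ⁻¹' {0} = (⋃ n, p ⁻¹' {n + 1})ᶜ := by
      ext x
      simp only [mem_preimage, mem_singleton_iff, mem_compl_iff, mem_iUnion, not_exists]
      exact ⟨fun hx n => by omega, fun hx => by
        by_contra h0
        exact hx (p x - 1) (by omega)⟩
    rw [this]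
    exact (MeasurableSet.iUnion hp').compl
  | succ n => exact hp' n

end SubRel

/-! ### Hardness of the finite index relations, and the theorem. -/

namespace SubRel

variable {X : Type*} [MeasurableSpace X] [StandardBorelSpace X] {R : Setoid X} {μ : Measure X}
  {T : ℕ → X → X} {m : Measure (X × X)}

theorem IsEnumeration.isFsigmaHard_subFiniteIndex [IsProbabilityMeasure μ] [IsFiniteMeasure m]
    (hT : IsEnumeration R μ T) (hap : IsAperiodic R μ) (hm : IsEquivLeftMeasure R μ m) :
    IsFsigmaHard (SubFiniteIndex R μ m) := by
  intro Z _ _ hZ B hB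
  obtain ⟨ℓ, hℓ, hcof⟩ := hT.exists_cofinite_level hap
  obtain ⟨g, hg, hgB⟩ := hB.exists_continuous_finite hZ
  -- A single piece suffices here: only one set of levels is encoded.
  have hp : Measurable fun _ : X => 0 := measurable_const
  refine ⟨fun z => levelSub hT m hp hℓ fun _ => g z,
    (continuous_levelSub hT hp hℓ).comp (continuous_pi fun _ => hg), ?_⟩
  have : Nonempty X := nonempty_of_isProbabilityMeasure μ
  ext z
  rw [mem_preimage, levelSub_mem_subFiniteIndex_iff hT hm hp hℓ (fun _ _ _ => rfl) hcof, hgB]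
  · simp
  · rintro _ ⟨x, rfl⟩
    simp [preimage_const_of_mem]

theorem IsEnumeration.isFsigmaDeltaHard_subFiniteIndex [IsProbabilityMeasure μ]
    [IsFiniteMeasure m] (hT : IsEnumeration R μ T) (hap : IsAperiodic R μ)
    (hm : IsEquivLeftMeasure R μ m) (hinf : HasInfinitelyManyErgodicComponents R μ) :
    IsFsigmaDeltaHard (SubFiniteIndex R μ m) := by
  rintro Z _ _ hZ B ⟨C, hC, rfl⟩
  obtain ⟨ℓ, hℓ, hcof⟩ := hT.exists_cofinite_level hap
  obtain ⟨p, hp, hpR, hpos⟩ := hinf.exists_partition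
  -- Row `n` of the matrix, acting on the `n`-th invariant piece, encodes membership in the `F_σ`
  -- set `C n`; finite index requires all rows to be finite.
  choose g hg hgC using fun n => (hC n).exists_continuous_finite hZ
  refine ⟨fun z => levelSub hT m hp hℓ fun n => g n z,
    (continuous_levelSub hT hp hℓ).comp (continuous_pi hg), ?_⟩
  have hsurj : ∀ n, n ∈ range p := fun n => by
    obtain ⟨x, hx⟩ := nonempty_of_measure_ne_zero (hpos n)
    exact ⟨x, hx⟩
  ext z
  rw [mem_preimage, levelSub_mem_subFiniteIndex_iff hT hm hp hℓ hpR hcof fun n _ => hpos n]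
  simp only [hsurj, forall_const, mem_iInter, hgC]

end SubRel

theorem mainTheorem8 {X : Type*} [MeasurableSpace X] [StandardBorelSpace X]
    (μ : Measure X) [IsProbabilityMeasure μ] (R : Setoid X)
    (hR : SubRel.IsNonsingular R μ) (hap : SubRel.IsAperiodic R μ)
    (m : Measure (X × X)) [IsFiniteMeasure m] (hm : SubRel.IsEquivLeftMeasure R μ m) :
    (SubRel.IsFsigmaDeltaHard (SubRel.SubFiniteIndex R μ m) ↔
      SubRel.HasInfinitelyManyErgodicComponents R μ) ∧
    (¬ SubRel.HasInfinitelyManyErgodicComponents R μ →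
      SubRel.IsFsigmaComplete (SubRel.SubFiniteIndex R μ m)) ∧
    (∀ k : ℕ, IsClosed (SubRel.SubIndexLE R μ m k)) := by
  obtain ⟨T, hT⟩ := hR.exists_isEnumeration
  refine ⟨⟨fun h hfin => (hT.isFsigma_subFiniteIndex hm hfin).not_isFsigmaDeltaHard h,
    hT.isFsigmaDeltaHard_subFiniteIndex hap hm⟩, fun h => ?_, hT.isClosed_subIndexLE hm⟩
  exact ⟨hT.isFsigma_subFiniteIndex hm (not_not.1 h), hT.isFsigmaHard_subFiniteIndex hap hm⟩
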